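/- Let $R$ be a Dedekind domain and let $A$ be a torsion-free $R$-module of finite rank, i.e. there is a finite upper bound on the sizes of $R$-linearly independent families in $A$ (equivalently, for the field of fractions $\mathbf Q$ of $R$, the $\mathbf Q$-vector space $\mathbf Q\otimes_R A$ is finite dimensional). For $R$-modules $M,N$, the module $M$ is called $N$-generated if there are a set $I$ and an $R$-linear epimorphism $N^{(I)}\to M$ from a direct sum of copies of $N$. A submodule $K$ of an $R$-module $N$ is called pure if every finite system of linear equations $\sum_{j} r_{ij}x_j=k_i$ with $r_{ij}\in R$ and $k_i\in K$ that has a solution in $N$ also has a solution in $K$. An $R$-module $N$ is called a self-pure-generator if every pure submodule of $N$ is $N$-generated. Then the following are equivalent: (a) $A$ is a self-pure-generator; (b) for every positive integer $n$, the direct power $A^n$ is a self-pure-generator; (c) there exists a positive integer $n$ such that $A^n$ is a self-pure-generator. -/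

import Mathlib

universe u v w

/-- Purity in the sense of Cohn, for left modules over an arbitrary ring: every finite system of
`R`-linear equations with constants in `K` that has a solution in `A` has a solution in `K`. -/
def Submodule.IsPureIn {R : Type u} [Ring R] {A : Type v} [AddCommGroup A] [Module R A]
    (K : Submodule R A) : Prop :=
  ∀ (m n : ℕ) (r : Fin m → Fin n → R) (k : Fin m → A), (∀ i, k i ∈ K) →
    (∃ x : Fin n → A, ∀ i, ∑ j, r i j • x j = k i) →
    ∃ y : Fin n → A, (∀ j, y j ∈ K) ∧ ∀ i, ∑ j, r i j • y j = k i

/-- `M` is `A`-generated: it is an epimorphic image of a direct sum `A^(I)` of copies of `A`.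
The set of all homomorphisms `A → M` would serve as `I`, so the universe of `I` loses nothing. -/
def Module.IsGeneratedBy (R : Type u) [Ring R] (A : Type v) [AddCommGroup A] [Module R A]
    (M : Type w) [AddCommGroup M] [Module R M] : Prop :=
  ∃ (I : Type (max v w)) (f : (I →₀ A) →ₗ[R] M), Function.Surjective f

/-- `A` is a self-pure-generator: every pure submodule of `A` is `A`-generated. -/
def Module.IsSelfPureGenerator (R : Type u) [Ring R] (A : Type v) [AddCommGroup A]
    [Module R A] : Prop :=
  ∀ K : Submodule R A, K.IsPureIn → Module.IsGeneratedBy R A K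

/-! Write `X_a` for `saturationOf R a`, which is pure in `A`. If `A` is a self-pure-generator, every
`X_a` is `A`-generated, so each nonzero `X_a` receives a nonzero map from `A`. Such maps yield lower
bounds for finitely many types, and finite rank then gives `b ≠ 0` of least type
(`exists_typeAbove_eq_top`). Each `x` in a pure `K ≤ A^n` has type at least that of `b`, and over a
Dedekind domain this puts `x` in the trace of `X_b` in `X_x ≤ K` (`mem_traceIn_saturationOf`, proved
locally at each maximal ideal). As `X_b` is `A`-generated, so is `K`. For the converse, embed `K` as
one coordinate of `A^n`. -/

open Submodule

/-! ### Generation as a full trace. -/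

section Trace

variable {R : Type u} [CommRing R]

/-- The trace of `N` in `M`: the sum of the images of all linear maps `N → M`. -/
def Module.traceIn (R : Type u) [CommRing R] (N : Type v) [AddCommGroup N] [Module R N]
    (M : Type w) [AddCommGroup M] [Module R M] : Submodule R M :=
  ⨆ f : N →ₗ[R] M, LinearMap.range f

variable {N : Type*} [AddCommGroup N] [Module R N]
  {M : Type*} [AddCommGroup M] [Module R M] {M' : Type*} [AddCommGroup M'] [Module R M']

theorem Module.apply_mem_traceIn (f : N →ₗ[R] M) (y : N) : f y ∈ Module.traceIn R N M :=
  (le_iSup (fun f : N →ₗ[R] M => LinearMap.range f) f) ⟨y, rfl⟩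

theorem Module.traceIn_le {K : Submodule R M} (h : ∀ (f : N →ₗ[R] M) (y : N), f y ∈ K) :
    Module.traceIn R N M ≤ K :=
  iSup_le fun f => by rintro _ ⟨y, rfl⟩; exact h f y

theorem Module.map_mem_traceIn (g : M →ₗ[R] M') {x : M} (hx : x ∈ Module.traceIn R N M) :
    g x ∈ Module.traceIn R N M' :=
  Module.traceIn_le (K := (Module.traceIn R N M').comap g)
    (fun f y => Module.apply_mem_traceIn (g ∘ₗ f) y) hx

end Trace

theorem Module.isGeneratedBy_iff_traceIn_eq_top {R : Type u} [CommRing R] {N : Type v}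
    [AddCommGroup N] [Module R N] {M : Type w} [AddCommGroup M] [Module R M] :
    Module.IsGeneratedBy R N M ↔ Module.traceIn R N M = ⊤ := by
  classical
  constructor
  · rintro ⟨I, f, hf⟩
    rw [eq_top_iff]
    rintro x -
    obtain ⟨c, rfl⟩ := hf x
    induction c using Finsupp.induction_linear with
    | zero => rw [map_zero]; exact zero_mem _
    | add c d hc hd => rw [map_add]; exact add_mem hc hd
    | single i y => exact Module.apply_mem_traceIn (f ∘ₗ Finsupp.lsingle i) y
  · intro h
    refine ⟨ULift (N →ₗ[R] M), Finsupp.lsum ℕ fun f => f.down, ?_⟩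
    rw [← LinearMap.range_eq_top, eq_top_iff, ← h]
    refine Module.traceIn_le fun f y => ⟨Finsupp.single ⟨f⟩ y, ?_⟩
    simp

theorem Module.mem_traceIn_of_isGeneratedBy {R : Type u} [CommRing R] {N : Type v}
    [AddCommGroup N] [Module R N] {Y : Type w} [AddCommGroup Y] [Module R Y]
    (h : Module.IsGeneratedBy R N Y) {M : Type*} [AddCommGroup M] [Module R M] {x : M}
    (hx : x ∈ Module.traceIn R Y M) : x ∈ Module.traceIn R N M :=
  Module.traceIn_le (fun f y => Module.map_mem_traceIn f
    ((Module.isGeneratedBy_iff_traceIn_eq_top.1 h).ge (mem_top : y ∈ ⊤))) hx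

/-! ### Rank-one saturations and their purity. -/

section Saturation

variable {R : Type u} [CommRing R] [IsDomain R] {A : Type v} [AddCommGroup A] [Module R A]

/-- The elements having a nonzero multiple in the cyclic submodule spanned by `b`. -/
def Submodule.saturationOf (R : Type u) [CommRing R] [IsDomain R] {A : Type v} [AddCommGroup A]
    [Module R A] (b : A) : Submodule R A where
  carrier := {y | ∃ s p : R, s ≠ 0 ∧ s • y = p • b}
  zero_mem' := ⟨1, 0, one_ne_zero, by simp⟩
  add_mem' := by
    rintro y z ⟨s, p, hs, h⟩ ⟨t, q, ht, h'⟩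
    refine ⟨s * t, t * p + s * q, mul_ne_zero hs ht, ?_⟩
    rw [smul_add, mul_comm s t, mul_smul, h, mul_comm t s, mul_smul s t, h', add_smul, mul_smul,
      mul_smul]
  smul_mem' := by
    rintro c y ⟨s, p, hs, h⟩
    exact ⟨s, c * p, hs, by rw [smul_comm, h, mul_smul]⟩

theorem Submodule.self_mem_saturationOf (b : A) : b ∈ saturationOf R b :=
  ⟨1, 1, one_ne_zero, rfl⟩

theorem Submodule.mem_saturationOf_of_smul_mem {b y : A} {s : R} (hs : s ≠ 0)
    (h : s • y ∈ saturationOf R b) : y ∈ saturationOf R b := by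
  obtain ⟨t, p, ht, h⟩ := h
  exact ⟨t * s, p, mul_ne_zero ht hs, by rw [mul_smul, h]⟩

theorem Submodule.IsPureIn.saturationOf_le [Module.IsTorsionFree R A] {K : Submodule R A}
    (hK : K.IsPureIn) {x : A} (hx : x ∈ K) : saturationOf R x ≤ K := by
  rintro y ⟨s, p, hs, h⟩
  obtain ⟨z, hz, e⟩ := hK 1 1 (fun _ _ => s) (fun _ => p • x) (fun _ => K.smul_mem _ hx)
    ⟨fun _ => y, by simpa using h⟩
  have e : s • z 0 = p • x := by simpa using e
  rw [← h] at e
  exact smul_right_injective A hs e ▸ hz 0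

end Saturation

/-- The quotient by the saturation is torsion-free, so its finitely generated submodules are
projective. Splitting off the image of a solution there corrects the solution to one inside the
saturation. -/
theorem Submodule.isPureIn_saturationOf {R : Type u} [CommRing R] [IsDedekindDomain R]
    {A : Type v} [AddCommGroup A] [Module R A] (b : A) : (saturationOf R b).IsPureIn := by
  classical
  set X := saturationOf R b
  have : Module.IsTorsionFree R (A ⧸ X) := by
    rw [Module.isTorsionFree_iff_smul_eq_zero]
    intro s y h
    by_contra! hc
    obtain ⟨y, rfl⟩ := X.mkQ_surjective y
    refine hc.2 ?_
    rw [← map_smul] at h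
    rw [mkQ_apply, Quotient.mk_eq_zero] at h ⊢
    exact mem_saturationOf_of_smul_mem hc.1 h
  rintro m n r k hk ⟨x, hx⟩
  let g : (Fin n → R) →ₗ[R] A := Fintype.linearCombination R x
  let h : (Fin n → R) →ₗ[R] A ⧸ X := X.mkQ ∘ₗ g
  have : Module.FinitePresentation R (LinearMap.range h) := Module.finitePresentation_of_finite _ _
  have : Module.IsTorsionFree R (LinearMap.range h) :=
    Function.Injective.moduleIsTorsionFree (LinearMap.range h).subtype Subtype.val_injective
      fun _ _ => rfl
  have : Module.Projective R (LinearMap.range h) := Module.Flat.projective_of_finitePresentation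
  obtain ⟨s, hs⟩ := h.rangeRestrict.exists_rightInverse_of_surjective h.range_rangeRestrict
  let ρ : (Fin n → R) →ₗ[R] A := g ∘ₗ (LinearMap.id - s ∘ₗ h.rangeRestrict)
  have hρ (v) : ρ v ∈ X := by
    rw [← Quotient.mk_eq_zero, ← mkQ_apply]
    have := congrArg Subtype.val (LinearMap.congr_fun hs (h.rangeRestrict v))
    change h (s (h.rangeRestrict v)) = h v at this
    change h (v - s (h.rangeRestrict v)) = 0
    rw [map_sub, this, sub_self]
  refine ⟨fun j => ρ (Pi.single j 1), fun j => hρ _, fun i => ?_⟩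
  have hr : ∑ j, r i j • (Pi.single j 1 : Fin n → R) = r i := by
    ext j; simp [Finset.sum_apply, Pi.single_apply]
  have hg : g (r i) = k i := by rw [← hx i]; simp [g, Fintype.linearCombination_apply]
  have hh : h.rangeRestrict (r i) = 0 := by
    ext
    change X.mkQ (g (r i)) = 0
    rw [hg, mkQ_apply, Quotient.mk_eq_zero]
    exact hk i
  simp_rw [← map_smul, ← map_sum]
  rw [hr]
  change g (r i - s (h.rangeRestrict (r i))) = k i
  rw [hh, map_zero, sub_zero, hg]

/-! ### Comparison of types. -/

section Conductor

variable {R : Type u} [CommRing R] [IsDomain R] {A : Type*} [AddCommGroup A] [Module R A]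
  {B : Type*} [AddCommGroup B] [Module R B]

/-- The scalars `e` such that every quotient `(p / s) • b` existing in `A` gives rise to a quotient
`(e * p / s) • x` in `B`. It is nonzero iff the type of `b` is at most the type of `x`. -/
def Module.typeConductor (R : Type u) [CommRing R] [IsDomain R] {A : Type*} [AddCommGroup A]
    [Module R A] {B : Type*} [AddCommGroup B] [Module R B] (b : A) (x : B) : Ideal R where
  carrier := {e | ∀ (s p : R) (y : A), s ≠ 0 → s • y = p • b → ∃ z : B, s • z = (e * p) • x}
  zero_mem' := fun _ _ _ _ _ => ⟨0, by simp⟩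
  add_mem' := by
    intro e e' he he' s p y hs h
    obtain ⟨z, hz⟩ := he s p y hs h
    obtain ⟨z', hz'⟩ := he' s p y hs h
    exact ⟨z + z', by rw [smul_add, hz, hz', add_mul, add_smul]⟩
  smul_mem' := by
    intro c e he s p y hs h
    obtain ⟨z, hz⟩ := he s p y hs h
    exact ⟨c • z, by rw [smul_comm, hz, smul_eq_mul, mul_assoc, mul_smul c]⟩

open Module

theorem Module.mem_typeConductor {b : A} {x : B} {e : R} : e ∈ typeConductor R b x ↔
    ∀ (s p : R) (y : A), s ≠ 0 → s • y = p • b → ∃ z : B, s • z = (e * p) • x := Iff.rfl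

theorem Module.typeConductor_ne_bot_iff {b : A} {x : B} :
    typeConductor R b x ≠ ⊥ ↔ ∃ e ∈ typeConductor R b x, e ≠ 0 := Submodule.ne_bot_iff _

theorem Module.typeConductor_trans {C : Type*} [AddCommGroup C] [Module R C] {b : A} {x : B}
    {c : C} (h : typeConductor R b x ≠ ⊥) (h' : typeConductor R x c ≠ ⊥) :
    typeConductor R b c ≠ ⊥ := by
  rw [typeConductor_ne_bot_iff] at *
  obtain ⟨e, he, he0⟩ := h
  obtain ⟨e', he', he0'⟩ := h'
  refine ⟨e' * e, fun s p y hs hy => ?_, mul_ne_zero he0' he0⟩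
  obtain ⟨z, hz⟩ := he s p y hs hy
  obtain ⟨z', hz'⟩ := he' s (e * p) z hs hz
  exact ⟨z', by rw [hz', mul_assoc]⟩

/-- The elements whose type is at least that of `b`. -/
def Module.typeAbove (R : Type u) [CommRing R] [IsDomain R] {A : Type*} [AddCommGroup A]
    [Module R A] (B : Type*) [AddCommGroup B] [Module R B] (b : A) : Submodule R B where
  carrier := {x | typeConductor R b x ≠ ⊥}
  zero_mem' := typeConductor_ne_bot_iff.2 ⟨1, fun _ _ _ _ _ => ⟨0, by simp⟩, one_ne_zero⟩
  add_mem' := by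
    intro x x' h h'
    rw [Set.mem_ofPred_eq, typeConductor_ne_bot_iff] at *
    obtain ⟨e, he, he0⟩ := h
    obtain ⟨e', he', he0'⟩ := h'
    refine ⟨e * e', fun s p y hs hy => ?_, mul_ne_zero he0 he0'⟩
    obtain ⟨z, hz⟩ := he s p y hs hy
    obtain ⟨z', hz'⟩ := he' s p y hs hy
    refine ⟨e' • z + e • z', ?_⟩
    rw [smul_add, smul_comm s e', smul_comm s e, hz, hz', smul_add]
    simp only [← mul_smul]
    congr 2 <;> ring
  smul_mem' := by
    intro c x h
    rw [Set.mem_ofPred_eq, typeConductor_ne_bot_iff] at *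
    obtain ⟨e, he, he0⟩ := h
    refine ⟨e, fun s p y hs hy => ?_, he0⟩
    obtain ⟨z, hz⟩ := he s p y hs hy
    exact ⟨c • z, by rw [smul_comm, hz, smul_comm]⟩

theorem Module.mem_typeAbove {b : A} {x : B} : x ∈ typeAbove R B b ↔ typeConductor R b x ≠ ⊥ :=
  Iff.rfl

theorem Module.mem_typeAbove_of_smul_mem [IsTorsionFree R B] {b : A} {x : B} {c : R} (hc : c ≠ 0)
    (h : c • x ∈ typeAbove R B b) : x ∈ typeAbove R B b := by
  rw [mem_typeAbove, typeConductor_ne_bot_iff] at *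
  obtain ⟨e, he, he0⟩ := h
  refine ⟨e * c, fun s p y hs hy => ?_, mul_ne_zero he0 hc⟩
  obtain ⟨z, hz⟩ := he s p y hs hy
  exact ⟨z, by rw [hz, ← mul_smul, mul_right_comm]⟩

theorem Module.pi_mem_typeAbove {n : ℕ} {b : A} {x : Fin n → A}
    (h : ∀ i, x i ∈ typeAbove R A b) : x ∈ typeAbove R (Fin n → A) b := by
  simp only [mem_typeAbove, typeConductor_ne_bot_iff] at *
  choose e he he0 using h
  refine ⟨∏ i, e i, fun s p y hs hy => ?_, Finset.prod_ne_zero_iff.2 fun i _ => he0 i⟩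
  have key (i) : ∃ z : A, s • z = ((∏ i, e i) * p) • x i :=
    ((typeConductor R b (x i)).mem_of_dvd (Finset.dvd_prod_of_mem e (Finset.mem_univ i)) (he i))
      s p y hs hy
  choose z hz using key
  exact ⟨z, funext hz⟩

theorem Module.mem_typeAbove_of_map_ne_zero [IsTorsionFree R B] {x : B}
    (f : A →ₗ[R] saturationOf R x) {b : A} (hb : f b ≠ 0) : x ∈ typeAbove R B b := by
  obtain ⟨v, u, hv, h⟩ := (f b).2
  have hb : (f b : B) ≠ 0 := by simpa using hb
  have hu : u ≠ 0 := by
    rintro rfl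
    rw [zero_smul] at h
    exact smul_ne_zero hv hb h
  refine typeConductor_ne_bot_iff.2 ⟨u, fun s p y hs hy => ⟨v • (f y : B), ?_⟩, hu⟩
  have := congrArg (fun a => (f a : B)) hy
  simp only [map_smul, coe_smul] at this
  rw [smul_comm, this, smul_comm, h, mul_comm, mul_smul]

/-- The map is `(p / s) b ↦ (e p / s) x`; torsion-freeness makes it independent of the fraction
chosen. -/
theorem Module.exists_map_saturationOf [IsTorsionFree R A] [IsTorsionFree R B] {b : A} (hb : b ≠ 0)
    {x : B} {e : R} (he : e ∈ typeConductor R b x) :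
    ∃ ψ : saturationOf R b →ₗ[R] saturationOf R x, ∀ (s p : R) (y : saturationOf R b),
      s ≠ 0 → s • (y : A) = p • b → s • (ψ y : B) = (e * p) • x := by
  have key (y : saturationOf R b) : ∃ z : B, ∀ s p : R, s ≠ 0 → s • (y : A) = p • b →
      s • z = (e * p) • x := by
    obtain ⟨s, p, hs, h⟩ := y.2
    obtain ⟨z, hz⟩ := he s p y hs h
    refine ⟨z, fun t q ht h' => smul_right_injective B hs ?_⟩
    have hqp : s * q = t * p := by
      apply smul_left_injective R hb
      simp only
      rw [mul_smul, ← h', mul_smul, ← h, smul_comm]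
    simp only
    rw [smul_comm, hz, ← mul_smul, ← mul_smul]
    congr 1
    linear_combination (-e) * hqp
  choose ψ hψ using key
  refine ⟨LinearMap.codRestrict _ { toFun := ψ, map_add' := ?_, map_smul' := ?_ } ?_, ?_⟩
  · intro y z
    obtain ⟨s, p, hs, h⟩ := y.2
    obtain ⟨t, q, ht, h'⟩ := z.2
    refine smul_right_injective B (mul_ne_zero hs ht) ?_
    simp only
    rw [hψ (y + z) (s * t) (t * p + s * q) (mul_ne_zero hs ht), smul_add,
      hψ y (s * t) (t * p) (mul_ne_zero hs ht), hψ z (s * t) (s * q) (mul_ne_zero hs ht),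
      ← add_smul, mul_add]
    · rw [mul_smul, h', mul_smul]
    · rw [mul_comm, mul_smul, h, mul_smul]
    · rw [coe_add, smul_add, mul_smul s t (z : A), h', mul_comm s t, mul_smul t s, h, add_smul,
        mul_smul, mul_smul]
  · intro c y
    obtain ⟨s, p, hs, h⟩ := y.2
    refine smul_right_injective B hs ?_
    simp only [RingHom.id_apply]
    rw [hψ (c • y) s (c * p) hs, smul_comm, hψ y s p hs h, ← mul_smul, mul_left_comm]
    rw [coe_smul, smul_comm, h, mul_smul]
  · intro y
    obtain ⟨s, p, hs, h⟩ := y.2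
    exact ⟨s, e * p, hs, hψ y s p hs h⟩
  · intro s p y hs h
    exact hψ y s p hs h

end Conductor

/-! ### Localization at maximal ideals, without fractions. -/

theorem Submodule.mem_of_forall_isMaximal_exists_smul_mem {R : Type*} [CommRing R] {M : Type*}
    [AddCommGroup M] [Module R M] (N : Submodule R M) (x : M)
    (h : ∀ P : Ideal R, P.IsMaximal → ∃ t ∉ P, t • x ∈ N) : x ∈ N := by
  by_contra hx
  let I : Ideal R := N.comap (LinearMap.toSpanSingleton R M x)
  have hI : I ≠ ⊤ := fun e => hx <| by
    have : (1 : R) ∈ I := e ▸ mem_top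
    simpa [I] using this
  obtain ⟨P, hP, hIP⟩ := I.exists_le_maximal hI
  obtain ⟨t, ht, h⟩ := h P hP
  exact ht (hIP h)

section Dedekind

variable {R : Type u} [CommRing R] [IsDedekindDomain R]

/-- This says that `R_P` is a valuation ring. Write `(a) = (a, b) J`; either `J` supplies a
multiplier outside `P`, or some `1 - j` with `j ∈ J ∩ P` does. -/
theorem IsDedekindDomain.exists_notMem_dvd_mul_or_dvd_mul (P : Ideal R) [P.IsMaximal] (a b : R) :
    ∃ w ∉ P, b ∣ w * a ∨ a ∣ w * b := by
  have h : Ideal.span {a, b} ∣ Ideal.span {a} :=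
    Ideal.dvd_iff_le.2 (Ideal.span_mono (by simp))
  obtain ⟨J, hJ⟩ := h
  have hb : ∀ j ∈ J, a ∣ j * b := fun j hj => by
    rw [← Ideal.mem_span_singleton, hJ, mul_comm j]
    exact Ideal.mul_mem_mul (Ideal.subset_span (by simp)) hj
  have ha : a ∈ Ideal.span {a, b} * J := hJ ▸ Ideal.mem_span_singleton_self a
  rw [Ideal.span_insert, Ideal.sup_mul, Submodule.mem_sup] at ha
  obtain ⟨y, hy, z, hz, hyz⟩ := ha
  obtain ⟨j, hj, rfl⟩ := Ideal.mem_span_singleton_mul.1 hy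
  obtain ⟨j', hj', rfl⟩ := Ideal.mem_span_singleton_mul.1 hz
  by_cases h : j ∈ P
  · refine ⟨1 - j, fun h' => Ideal.IsPrime.ne_top' ((Ideal.eq_top_iff_one P).2 ?_), Or.inl ⟨j', ?_⟩⟩
    · simpa using P.add_mem h' h
    · linear_combination -hyz
  · exact ⟨j, h, Or.inr (hb j hj)⟩

theorem IsDedekindDomain.exists_local_uniformizer (P : Ideal R) [P.IsMaximal] (hP : P ≠ ⊥) :
    ∃ π ∈ P, π ≠ 0 ∧ ∀ a ∈ P, ∃ v ∉ P, π ∣ v * a := by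
  have hprime : Prime P := Ideal.prime_of_isPrime hP inferInstance
  have hlt : P ^ 2 < P := by
    simpa using Ideal.pow_right_strictAnti P hP Ideal.IsPrime.ne_top' (show 1 < 2 by norm_num)
  obtain ⟨π, hπ, hπ2⟩ := SetLike.exists_of_lt hlt
  have h0 : π ≠ 0 := by rintro rfl; exact hπ2 (zero_mem _)
  obtain ⟨J, hJ⟩ := Ideal.dvd_iff_le.2 ((Ideal.span_singleton_le_iff_mem P).2 hπ)
  have hJP : ¬ J ≤ P := fun h => hπ2 <| by
    rw [← Ideal.span_singleton_le_iff_mem, hJ, sq]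
    exact Ideal.mul_mono_right h
  obtain ⟨v, hv, hvP⟩ := SetLike.not_le_iff_exists.1 hJP
  refine ⟨π, hπ, h0, fun a ha => ⟨v, hvP, ?_⟩⟩
  rw [← Ideal.mem_span_singleton, hJ, mul_comm v]
  exact Ideal.mul_mem_mul ha hv

/-- Factor `(c) = P ^ k * J` with `P ∤ J` and take `r ∈ J \ P`. -/
theorem IsDedekindDomain.exists_local_generator (P : Ideal R) [P.IsMaximal] (hP : P ≠ ⊥) {c : R}
    (hc : c ≠ 0) : ∃ (k : ℕ) (r : R), r ∉ P ∧ (∀ π ∈ P, c ∣ r * π ^ k) ∧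
      ∀ Q : Ideal R, Q.IsMaximal → Q ≠ P → ∃ w ∉ Q, c ∣ w * r := by
  have hprime : Prime P := Ideal.prime_of_isPrime hP inferInstance
  have hc' : Ideal.span {c} ≠ 0 := by simpa using hc
  obtain ⟨J, hJ, hdvd⟩ := (FiniteMultiplicity.of_prime_left hprime hc').exists_eq_pow_mul_and_not_dvd
  rw [Ideal.dvd_iff_le] at hdvd
  generalize multiplicity P (Ideal.span {c}) = k at hJ
  obtain ⟨r, hr, hrP⟩ := SetLike.not_le_iff_exists.1 hdvd
  refine ⟨k, r, hrP, fun π hπ => ?_, fun Q hQ hQP => ?_⟩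
  · rw [← Ideal.mem_span_singleton, hJ, mul_comm r]
    exact Ideal.mul_mem_mul (Ideal.pow_mem_pow hπ _) hr
  · have : ¬ P ≤ Q := fun h => hQP ((Ideal.IsMaximal.eq_of_le ‹_› hQ.ne_top h).symm)
    obtain ⟨w, hw, hwQ⟩ := SetLike.not_le_iff_exists.1 this
    refine ⟨w ^ k, fun h => hwQ (hQ.isPrime.mem_of_pow_mem _ h), ?_⟩
    rw [← Ideal.mem_span_singleton, hJ]
    exact Ideal.mul_mem_mul (Ideal.pow_mem_pow hw _) hr

open Module

variable {A : Type*} [AddCommGroup A] [Module R A] [IsTorsionFree R A]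
  {B : Type*} [AddCommGroup B] [Module R B]

/-- If `r π ^ m` does not carry the type of `b` into that of `x`, although `r` is harmless away
from `P`, then the obstruction is at `P`, where `b` must be divisible by `π ^ (m + 1)`. -/
theorem Module.exists_smul_eq_pow_smul_of_notMem_typeConductor {b : A} {x : B} {c : R}
    (hc : c ∈ typeConductor R b x) (P : Ideal R) [P.IsMaximal] {π : R}
    (hπ : ∀ a ∈ P, ∃ v ∉ P, π ∣ v * a) {r : R}
    (hr : ∀ Q : Ideal R, Q.IsMaximal → Q ≠ P → ∃ w ∉ Q, c ∣ w * r) {m : ℕ}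
    (hm : r * π ^ m ∉ typeConductor R b x) :
    ∃ u ∉ P, ∃ y : A, π ^ (m + 1) • y = u • b := by
  rw [mem_typeConductor] at hm
  push Not at hm
  obtain ⟨s, p, y, hs, hy, hz⟩ := hm
  have hp : p ≠ 0 := by
    rintro rfl
    exact hz 0 (by simp)
  by_contra! hu
  refine absurd (mem_of_forall_isMaximal_exists_smul_mem
    (LinearMap.range (LinearMap.lsmul R B s)) ((r * π ^ m * p) • x) fun Q hQ => ?_) ?_
  · by_cases hQP : Q = P
    · subst hQP
      have key {t a : R} (ht : s * a = t * (π ^ m * p)) :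
          t • (r * π ^ m * p) • x ∈ LinearMap.range (LinearMap.lsmul R B s) := by
        refine ⟨(r * a) • x, ?_⟩
        rw [LinearMap.lsmul_apply, ← mul_smul, ← mul_smul]
        congr 1
        linear_combination r * ht
      obtain ⟨w, hw, ⟨t, ht⟩ | ⟨t, ht⟩⟩ :=
        IsDedekindDomain.exists_notMem_dvd_mul_or_dvd_mul Q (π ^ m * p) s
      · exact ⟨w, hw, key ht.symm⟩
      · refine ⟨t, fun htQ => ?_, key (a := w) (by rw [mul_comm, ht, mul_comm])⟩
        -- If `t ∈ P`, one more factor `π` splits off, and cancelling `p` makes `v * w` times `b`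
        -- divisible by `π ^ (m + 1)`, against `hu`.
        obtain ⟨v, hv, t', ht'⟩ := hπ t htQ
        refine hu (v * w) (fun h => (hQ.isPrime.mem_or_mem h).elim hv hw) (t' • y)
          (smul_right_injective A hp ?_)
        simp only
        rw [smul_comm p (v * w), ← hy, ← mul_smul, ← mul_smul, ← mul_smul]
        congr 1
        linear_combination (-v) * ht - π ^ m * p * ht'
    · obtain ⟨w, hw, t, ht⟩ := hr Q hQ hQP
      obtain ⟨z, hz⟩ := hc s p y hs hy
      refine ⟨w, hw, (t * π ^ m) • z, ?_⟩
      rw [LinearMap.lsmul_apply, smul_comm, hz, ← mul_smul, ← mul_smul]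
      congr 1
      linear_combination (-π ^ m * p) * ht
  · rintro ⟨z, h⟩
    exact hz z h

theorem Module.mem_traceIn_saturationOf [IsTorsionFree R B] {b : A} (hb : b ≠ 0) {x : B}
    (hx : x ∈ typeAbove R B b) :
    (⟨x, self_mem_saturationOf x⟩ : saturationOf R x) ∈
      traceIn R (saturationOf R b) (saturationOf R x) := by
  refine mem_of_forall_isMaximal_exists_smul_mem _ _ fun P hP => ?_
  obtain ⟨c, hc, hc0⟩ := typeConductor_ne_bot_iff.1 hx
  have key {e u s : R} (y : A) (hs : s ≠ 0) (h : s • y = u • b)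
      (he : e * s ∈ typeConductor R b x) :
      (e * u) • (⟨x, self_mem_saturationOf x⟩ : saturationOf R x) ∈
        traceIn R (saturationOf R b) (saturationOf R x) := by
    obtain ⟨ψ, hψ⟩ := exists_map_saturationOf hb he
    have := apply_mem_traceIn ψ ⟨y, s, u, hs, h⟩
    convert this
    refine Subtype.ext (smul_right_injective B hs ?_)
    simp only
    rw [hψ s u ⟨y, s, u, hs, h⟩ hs h, coe_smul, ← mul_smul]
    congr 1
    ring
  by_cases hcP : c ∈ P
  · have hP0 : P ≠ ⊥ := by rintro rfl; exact hc0 hcP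
    obtain ⟨π, hπP, hπ0, hπ⟩ := IsDedekindDomain.exists_local_uniformizer P hP0
    obtain ⟨k, r, hrP, hrc, hr⟩ := IsDedekindDomain.exists_local_generator P hP0 hc0
    -- Descend to the least usable exponent. If it is positive, its minimality forces `b` to be
    -- divisible by that power of `π` up to a unit at `P`, which cancels the power in the map.
    have main (m : ℕ) (hm : r * π ^ m ∈ typeConductor R b x) :
        ∃ t ∉ P, t • (⟨x, self_mem_saturationOf x⟩ : saturationOf R x) ∈
          traceIn R (saturationOf R b) (saturationOf R x) := by
      induction m with
      | zero => exact ⟨r * 1, by simpa using hrP, key b one_ne_zero rfl (by simpa using hm)⟩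
      | succ m ih =>
        by_cases h : r * π ^ m ∈ typeConductor R b x
        · exact ih h
        · obtain ⟨u, hu, y, hy⟩ :=
            exists_smul_eq_pow_smul_of_notMem_typeConductor hc P hπ hr h
          exact ⟨r * u, fun h => (hP.isPrime.mem_or_mem h).elim hrP hu,
            key y (pow_ne_zero _ hπ0) hy hm⟩
    exact main k (Ideal.mem_of_dvd _ (hrc π hπP) hc)
  · exact ⟨c * 1, by simpa using hcP, key b one_ne_zero rfl (by simpa using hc)⟩

end Dedekind

/-! ### An element of least type. -/

section LeastType

open Module

variable {R : Type u} [CommRing R] {A : Type v} [AddCommGroup A] [Module R A]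

/-- A group is not the union of two proper subgroups, here the kernels. -/
theorem LinearMap.exists_map_ne_zero_and_map_ne_zero {M : Type*} [AddCommGroup M] [Module R M]
    {M' : Type*} [AddCommGroup M'] [Module R M'] {f : A →ₗ[R] M} {g : A →ₗ[R] M'}
    (hf : f ≠ 0) (hg : g ≠ 0) : ∃ d, f d ≠ 0 ∧ g d ≠ 0 := by
  obtain ⟨a, ha⟩ := DFunLike.ne_iff.1 hf
  obtain ⟨a', ha'⟩ := DFunLike.ne_iff.1 hg
  by_contra! h
  have h1 := h a ha
  have h2 : f a' = 0 := by_contra fun e => ha' (h a' e)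
  exact ha' (by simpa [h1] using h (a + a') (by simpa [h2] using ha))

theorem Module.IsGeneratedBy.exists_ne_zero {M : Type w} [AddCommGroup M] [Module R M]
    [Nontrivial M] (h : Module.IsGeneratedBy R A M) : ∃ f : A →ₗ[R] M, f ≠ 0 := by
  by_contra! h0
  rw [isGeneratedBy_iff_traceIn_eq_top] at h
  have : traceIn R A M ≤ ⊥ := traceIn_le fun f y => by simp [h0 f]
  exact bot_ne_top (le_bot_iff.1 this ▸ h)

variable [IsDomain R] [IsTorsionFree R A]

theorem Module.exists_forall_mem_finset_mem_typeAbove [Nontrivial A]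
    (h : ∀ a : A, IsGeneratedBy R A (saturationOf R a)) (S : Finset A) :
    ∃ b : A, b ≠ 0 ∧ ∀ a ∈ S, a ∈ typeAbove R A b := by
  classical
  have hnt {a : A} (ha : a ≠ 0) : ∃ f : A →ₗ[R] saturationOf R a, f ≠ 0 := by
    have : Nontrivial (saturationOf R a) :=
      ⟨⟨⟨a, self_mem_saturationOf a⟩, 0, fun e => ha (congrArg Subtype.val e)⟩⟩
    exact (h a).exists_ne_zero
  induction S using Finset.induction_on with
  | empty => obtain ⟨b, hb⟩ := exists_ne (0 : A); exact ⟨b, hb, by simp⟩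
  | insert a S _ ih =>
    obtain ⟨b, hb, hS⟩ := ih
    by_cases ha : a = 0
    · refine ⟨b, hb, ?_⟩
      rw [Finset.forall_mem_insert]
      exact ⟨ha ▸ zero_mem _, hS⟩
    obtain ⟨f, hf⟩ := hnt ha
    obtain ⟨g, hg⟩ := hnt hb
    -- Nonzero images in `X_a` and `X_b` bound the type of `d` by those of both `a` and `b`.
    obtain ⟨d, hfd, hgd⟩ := LinearMap.exists_map_ne_zero_and_map_ne_zero hf hg
    refine ⟨d, by rintro rfl; exact hfd (map_zero f), ?_⟩
    rw [Finset.forall_mem_insert]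
    exact ⟨mem_typeAbove_of_map_ne_zero f hfd,
      fun a ha => typeConductor_trans (mem_typeAbove_of_map_ne_zero g hgd) (hS a ha)⟩

/-- A lower bound for a finite maximal independent set suffices, since `typeAbove` is a submodule
closed under division by nonzero scalars. -/
theorem Module.exists_typeAbove_eq_top [Nontrivial A] (hA : Module.rank R A < Cardinal.aleph0)
    (h : ∀ a : A, IsGeneratedBy R A (saturationOf R a)) :
    ∃ b : A, b ≠ 0 ∧ typeAbove R A b = ⊤ := by
  obtain ⟨s, hs, hmax⟩ := exists_maximal_linearIndepOn R (id : A → A)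
  have hfin : s.Finite :=
    Cardinal.lt_aleph0_iff_set_finite.1 (hs.linearIndependent.cardinal_le_rank.trans_lt hA)
  obtain ⟨b, hb, hS⟩ := exists_forall_mem_finset_mem_typeAbove h hfin.toFinset
  have hspan : span R (id '' s) ≤ typeAbove R A b := by
    rw [span_le, Set.image_id]
    exact fun a ha => hS a (by simpa using ha)
  refine ⟨b, hb, eq_top_iff.2 fun a _ => ?_⟩
  by_cases ha : a ∈ s
  · exact hS a (by simpa using ha)
  · obtain ⟨c, hc, hca⟩ := hmax a ha
    exact mem_typeAbove_of_smul_mem hc (hspan hca)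

end LeastType

/-! ### Passage between a module and its powers. -/

theorem Module.IsSelfPureGenerator.pi {R : Type u} [CommRing R] [IsDedekindDomain R]
    {A : Type v} [AddCommGroup A] [Module R A] [Module.IsTorsionFree R A]
    (hA : Module.rank R A < Cardinal.aleph0) (h : Module.IsSelfPureGenerator R A) {n : ℕ}
    (hn : 0 < n) : Module.IsSelfPureGenerator R (Fin n → A) := by
  intro K hK
  rw [isGeneratedBy_iff_traceIn_eq_top, eq_top_iff]
  rintro ⟨x, hx⟩ -
  cases subsingleton_or_nontrivial A with
  | inl _ =>
    have : (⟨x, hx⟩ : K) = 0 := Subtype.ext (Subsingleton.elim _ _)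
    exact this ▸ zero_mem _
  | inr _ =>
    have hsat (a : A) : IsGeneratedBy R A (saturationOf R a) := h _ (isPureIn_saturationOf a)
    obtain ⟨b, hb, htop⟩ := exists_typeAbove_eq_top hA hsat
    have hx' : x ∈ typeAbove R (Fin n → A) b := pi_mem_typeAbove fun i => htop ▸ mem_top
    have h1 := mem_traceIn_of_isGeneratedBy (hsat b) (mem_traceIn_saturationOf hb hx')
    have h2 := map_mem_traceIn (Submodule.inclusion (hK.saturationOf_le hx)) h1
    exact traceIn_le (K := traceIn R (Fin n → A) K) (fun f y =>
      apply_mem_traceIn (f ∘ₗ LinearMap.proj (⟨0, hn⟩ : Fin n)) fun _ => y) h2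

theorem Module.IsSelfPureGenerator.of_pi {R : Type u} [CommRing R]
    {A : Type v} [AddCommGroup A] [Module R A] {n : ℕ}
    (hn : 0 < n) (h : Module.IsSelfPureGenerator R (Fin n → A)) :
    Module.IsSelfPureGenerator R A := by
  classical
  intro K hK
  let i₀ : Fin n := ⟨0, hn⟩
  let L : Submodule R (Fin n → A) := K.map (LinearMap.single R (fun _ => A) i₀)
  have hL : L.IsPureIn := by
    rintro m l r k hk ⟨x, hx⟩
    choose k' hk' hkk' using hk
    obtain ⟨y, hy, hyk⟩ := hK m l r k' hk' ⟨fun j => x j i₀, fun i => by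
      have := congrFun (hx i) i₀
      rw [← hkk' i] at this
      simpa [Finset.sum_apply] using this⟩
    refine ⟨fun j => LinearMap.single R (fun _ => A) i₀ (y j), fun j => mem_map_of_mem (hy j),
      fun i => ?_⟩
    rw [← hkk' i, ← hyk i, map_sum]
    simp_rw [map_smul]
  have hgen := isGeneratedBy_iff_traceIn_eq_top.1 (h L hL)
  let q : L →ₗ[R] K := ((LinearMap.proj i₀).comp L.subtype).codRestrict K <| by
    rintro ⟨_, a, ha, rfl⟩
    simpa using ha
  rw [isGeneratedBy_iff_traceIn_eq_top, eq_top_iff]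
  rintro ⟨x, hx⟩ -
  have hq : q ⟨_, mem_map_of_mem hx⟩ = ⟨x, hx⟩ := Subtype.ext (by simp [q])
  rw [← hq]
  refine traceIn_le (K := (traceIn R A K)) (fun f y => ?_)
    (map_mem_traceIn q (hgen.ge (mem_top : (⟨_, mem_map_of_mem hx⟩ : L) ∈ ⊤)))
  -- A map out of `A^n` is the sum of its restrictions to the coordinates.
  rw [← LinearMap.sum_single_apply (fun _ : Fin n => A) y, map_sum]
  exact sum_mem fun i _ => apply_mem_traceIn (f ∘ₗ LinearMap.single R (fun _ => A) i) (y i)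

theorem corollary2p5 {R : Type u} [CommRing R] [IsDedekindDomain R]
    {A : Type v} [AddCommGroup A] [Module R A] [Module.IsTorsionFree R A]
    (hA : Module.rank R A < Cardinal.aleph0) :
    List.TFAE
      [Module.IsSelfPureGenerator R A,
       ∀ n : ℕ, 0 < n → Module.IsSelfPureGenerator R (Fin n → A),
       ∃ n : ℕ, 0 < n ∧ Module.IsSelfPureGenerator R (Fin n → A)] := by
  tfae_have 1 → 2 := fun h _ hn => h.pi hA hn
  tfae_have 2 → 3 := fun h => ⟨1, one_pos, h 1 one_pos⟩
  tfae_have 3 → 1 := fun ⟨_, hn, h⟩ => h.of_pi hn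
  tfae_finish
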